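/- Let $n\in\mathbb N$, $T>0$, and let $u_0:\mathbb R^n\to\mathbb R$ be locally Lipschitz (not necessarily proper) and bounded from below. Assume that the gradient function $v_0=\sqrt{1+|Du_0|^2}$, which is defined almost everywhere, satisfies: for every $M\in\mathbb R$ there is a constant $c(M)$ with $$\operatorname*{ess\,sup}_{\{x\,:\,u_0(x)<M\}} v_0\le c(M).$$ Let $u_1,u_2:\mathbb R^n\times(0,T]\to\mathbb R$ be two smooth solutions of graphical mean curvature flow $$u_t=\Big(\delta^{ij}-\frac{D_iu\,D_ju}{1+|Du|^2}\Big)D_{ij}u\qquad\text{on }\mathbb R^n\times(0,T]$$ with the same initial data $u_0$, that is, $\lim_{t\to0}u_1(\cdot,t)=\lim_{t\to0}u_2(\cdot,t)=u_0$ uniformly on compact subsets of $\mathbb R^n$. For a solution $u$ with graphs $M_t=\{(x,u(x,t)):x\in\mathbb R^n\}$ let $$v=\sqrt{1+|Du|^2},\qquad g_{ij}=\delta_{ij}+D_iu\,D_ju,\qquad h^i_j=\Big(\delta^{il}-\frac{D_iu\,D_lu}{1+|Du|^2}\Big)\frac{D_{lj}u}{\sqrt{1+|Du|^2}}$$ be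 the gradient function, the induced metric and the second fundamental form (shape operator) of $M_t$. Assume that each of $u_1,u_2$ satisfies, with some constant $c>0$, $$v\,h^i_j\ge -c\,\delta^i_j\qquad\text{on }M_t\text{ for all }t\in(0,T],$$ as an inequality between operators that are self-adjoint with respect to $g$, that is, $g(v\,h\,\xi,\xi)\ge -c\,g(\xi,\xi)$ for all $\xi\in\mathbb R^n$. Then $u_1=u_2$ on $\mathbb R^n\times(0,T]$; that is, the graphs $M^1_t$ and $M^2_t$ of $u_1(\cdot,t)$ and $u_2(\cdot,t)$ coincide for all $t\in(0,T]$. -/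

import Mathlib

namespace GraphMCF

open Set Filter Topology MeasureTheory
open scoped Matrix ContDiff

noncomputable section

/-- Euclidean space `ℝⁿ`. -/
abbrev E (n : ℕ) : Type := EuclideanSpace ℝ (Fin n)

/-- The partial derivative `D_i f (x)`. -/
def pd {n : ℕ} (i : Fin n) (f : E n → ℝ) (x : E n) : ℝ :=
  fderiv ℝ f x (EuclideanSpace.single i 1)

/-- The Hessian matrix `D_{ij} f (x)`. -/
def hess {n : ℕ} (f : E n → ℝ) (x : E n) : Matrix (Fin n) (Fin n) ℝ :=
  Matrix.of fun i j => pd i (pd j f) x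

/-- `|Df(x)|²`. -/
def gradSq {n : ℕ} (f : E n → ℝ) (x : E n) : ℝ :=
  ∑ i, pd i f x ^ 2

/-- The gradient function `v = ⟨e_{n+1}, ν⟩⁻¹ = √(1 + |Df|²)` of the graph of `f`,
where `ν` is the upward unit normal. -/
def gradFun {n : ℕ} (f : E n → ℝ) (x : E n) : ℝ :=
  Real.sqrt (1 + gradSq f x)

/-- The metric `g_{ij} = δ_{ij} + D_i f D_j f` induced on the graph of `f`, in the coordinates
`x ↦ (x, f x)`. -/
def metric {n : ℕ} (f : E n → ℝ) (x : E n) : Matrix (Fin n) (Fin n) ℝ :=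
  Matrix.of fun i j => (if i = j then 1 else 0) + pd i f x * pd j f x

/-- The inverse metric `g^{ij} = δ^{ij} - D_i f D_j f / (1 + |Df|²)`. -/
def invMetric {n : ℕ} (f : E n → ℝ) (x : E n) : Matrix (Fin n) (Fin n) ℝ :=
  Matrix.of fun i j => (if i = j then 1 else 0) - pd i f x * pd j f x / (1 + gradSq f x)

/-- The second fundamental form with one index raised (the shape operator) of the graph of `f`:
`h^i_j = (δ^{il} - D_i f D_l f / (1 + |Df|²)) D_{lj} f / √(1 + |Df|²)`. -/
def shapeOp {n : ℕ} (f : E n → ℝ) (x : E n) : Matrix (Fin n) (Fin n) ℝ :=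
  (gradFun f x)⁻¹ • (invMetric f x * hess f x)

/-- `v h^i_j ≥ -c δ^i_j` at the point `(x, f x)` of the graph of `f`. The shape operator is
self-adjoint for the induced metric `g` on the tangent space, and the inequality is the one between
`g`-self-adjoint operators: `g(v h ξ, ξ) ≥ -c g(ξ, ξ)` for all tangent vectors `ξ`. -/
def CurvBoundAt {n : ℕ} (c : ℝ) (f : E n → ℝ) (x : E n) : Prop :=
  ∀ ξ : Fin n → ℝ,
    -c * (ξ ⬝ᵥ (metric f x *ᵥ ξ)) ≤ ξ ⬝ᵥ (metric f x *ᵥ ((gradFun f x • shapeOp f x) *ᵥ ξ))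

/-- The lower curvature bound `v h^i_j ≥ -c δ^i_j` on all `M_t`, `t ∈ (0, T]`, with a uniform
constant `c > 0`. -/
def CurvBound {n : ℕ} (T : ℝ) (u : E n → ℝ → ℝ) : Prop :=
  ∃ c : ℝ, 0 < c ∧ ∀ t ∈ Ioc 0 T, ∀ x, CurvBoundAt c (fun y => u y t) x

/-- `u : ℝⁿ × (0, T] → ℝ` is a smooth solution of graphical mean curvature flow with initial
data `u₀`. The values of `u` for `t` outside `(0, T]` play no role. -/
structure IsSmoothSolution {n : ℕ} (T : ℝ) (u₀ : E n → ℝ) (u : E n → ℝ → ℝ) : Prop where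
  smooth : ContDiffOn ℝ ∞ (fun p : E n × ℝ => u p.1 p.2) (univ ×ˢ Ioc 0 T)
  /-- `u_t = (δ^{ij} - D_i u D_j u / (1 + |Du|²)) D_{ij} u`; the time derivative is one-sided
  at `t = T`. -/
  eqn : ∀ t ∈ Ioc 0 T, ∀ x,
    derivWithin (fun s => u x s) (Ioc 0 T) t =
      ∑ i, ∑ j, invMetric (fun y => u y t) x i j * hess (fun y => u y t) x i j
  /-- `u(·, t) → u₀` as `t → 0`, uniformly on compact subsets of `ℝⁿ`. -/
  initial : TendstoLocallyUniformly (fun t x => u x t) u₀ (𝓝[>] (0 : ℝ))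

/-- The gradient function `v₀` of the locally Lipschitz function `u₀` (which is defined almost
everywhere) is bounded on every sublevel set `{u₀ < M}`. -/
def GradBddOnSublevels {n : ℕ} (u₀ : E n → ℝ) : Prop :=
  ∀ M : ℝ, ∃ C : ℝ, ∀ᵐ x ∂(volume : Measure (E n)), u₀ x < M → gradFun u₀ x ≤ C

/-- The entire graph `{(x, f x) : x ∈ ℝⁿ}` in `ℝⁿ × ℝ`. -/
def entireGraph {n : ℕ} (f : E n → ℝ) : Set (E n × ℝ) :=
  range fun x => (x, f x)

end

end GraphMCF

namespace GraphMCF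

open Set Filter Topology
open scoped Matrix ContDiff MatrixOrder

noncomputable section

/-! It suffices to prove u₁ ≤ u₂ and exchange the roles. Put aᵢ = exp(-uᵢ). The lower curvature
bound gives ∂ₜu₂ ≥ -nc, so a₂ is bounded and the penalty ε|x|² makes a positive supremum of a₂ - a₁
attained. At such a maximum a₁Du₁ = a₂Du₂ + O(ε|x|) and a₂ > a₁, so up to the error Du₁ is a longer
multiple of Du₂ and g₁⁻¹ ≤ g₂⁻¹. The dangerous term, the difference of the coefficients contracted
with D²u₂, thus has a favourable sign after adding c g₂ to D²u₂, and the price of this addition is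
O(a₂ - a₁). A Gronwall factor absorbs it.

The gradient error spoils exact monotonicity. Running u₁ at speed 1 - κ leaves room for it: only (1
- κ)g₁⁻¹ ≤ g₂⁻¹ is needed (`bform_graphInv_mono`), at a cost O(κ). The algebra is
`pairing_graphInv_sub_le`, the maximum argument `exp_sub_exp_le_penalty`; then ε → 0, and finally κ
→ 0. -/

/-! ### Trace pairings and quadratic forms. -/

/-- The inverse `I - p pᵀ / (1 + |p|²)` of the metric of a graph with gradient `p`. -/
def graphInv {n : ℕ} (p : Fin n → ℝ) : Matrix (Fin n) (Fin n) ℝ :=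
  Matrix.of fun i j => (if i = j then 1 else 0) - p i * p j / (1 + ∑ i, p i ^ 2)

/-- The trace pairing `A^{ij} S_{ij}`. -/
def pairing {n : ℕ} (A S : Matrix (Fin n) (Fin n) ℝ) : ℝ := ∑ i, ∑ j, A i j * S i j

/-- The bilinear form `ξ S ζ` of a matrix. -/
def bform {n : ℕ} (S : Matrix (Fin n) (Fin n) ℝ) (ξ ζ : Fin n → ℝ) : ℝ :=
  ∑ i, ∑ j, ξ i * ζ j * S i j

/-- Writing A = CᵀC turns the pairing into the sum of the values of the form S on the rows of C. -/
lemma pairing_nonneg {n : ℕ} {A S : Matrix (Fin n) (Fin n) ℝ} (hA : A.PosSemidef)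
    (hS : ∀ ξ, 0 ≤ bform S ξ ξ) : 0 ≤ pairing A S := by
  obtain ⟨C, hC⟩ := CStarAlgebra.nonneg_iff_eq_star_mul_self.1 (Matrix.nonneg_iff_posSemidef.2 hA)
  have hAij : ∀ i j, A i j = ∑ k, C k i * C k j := by
    intro i j
    rw [hC, Matrix.mul_apply]
    simp [Matrix.star_apply]
  have : pairing A S = ∑ k, bform S (C k) (C k) := by
    simp only [pairing, bform, hAij, Finset.sum_mul]
    conv_rhs => rw [Finset.sum_comm]
    refine Finset.sum_congr rfl fun i _ => ?_
    rw [Finset.sum_comm]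
  rw [this]
  exact Finset.sum_nonneg fun k _ => hS _

lemma bform_graphInv {n : ℕ} (p ξ ζ : Fin n → ℝ) :
    bform (graphInv p) ξ ζ = ξ ⬝ᵥ ζ - (p ⬝ᵥ ξ) * (p ⬝ᵥ ζ) / (1 + ∑ i, p i ^ 2) := by
  simp only [bform, graphInv, Matrix.of_apply, mul_sub, Finset.sum_sub_distrib, dotProduct]
  congr 1
  · simp
  · rw [Finset.sum_mul_sum, Finset.sum_div]
    refine Finset.sum_congr rfl fun i _ => ?_
    rw [Finset.sum_div]
    exact Finset.sum_congr rfl fun j _ => by ring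

lemma one_add_sum_sq_pos {n : ℕ} (p : Fin n → ℝ) : 0 < 1 + ∑ i, p i ^ 2 := by positivity

lemma sum_sq_eq_dotProduct {n : ℕ} (p : Fin n → ℝ) : ∑ i, p i ^ 2 = p ⬝ᵥ p := by
  simp [dotProduct, sq]

lemma pairing_graphInv_one {n : ℕ} (p : Fin n → ℝ) :
    pairing (graphInv p) 1 = n - (p ⬝ᵥ p) / (1 + ∑ i, p i ^ 2) := by
  simp [pairing, graphInv, Matrix.one_apply, Finset.sum_sub_distrib, dotProduct, Finset.sum_div]

lemma pairing_vecMulVec {n : ℕ} (A : Matrix (Fin n) (Fin n) ℝ) (q : Fin n → ℝ) :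
    pairing A (Matrix.vecMulVec q q) = bform A q q := by
  simp only [pairing, bform, Matrix.vecMulVec_apply]
  exact Finset.sum_congr rfl fun i _ => Finset.sum_congr rfl fun j _ => by ring

lemma pairing_add {n : ℕ} (A S R : Matrix (Fin n) (Fin n) ℝ) :
    pairing A (S + R) = pairing A S + pairing A R := by
  simp [pairing, mul_add, Finset.sum_add_distrib]

lemma pairing_smul {n : ℕ} (r : ℝ) (A S : Matrix (Fin n) (Fin n) ℝ) :
    pairing A (r • S) = r * pairing A S := by
  simp only [pairing, Finset.mul_sum, Matrix.smul_apply, smul_eq_mul]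
  exact Finset.sum_congr rfl fun i _ => Finset.sum_congr rfl fun j _ => by ring

lemma pairing_comm {n : ℕ} (A S : Matrix (Fin n) (Fin n) ℝ) : pairing A S = pairing S A := by
  simp [pairing, mul_comm]

lemma bform_eq_pairing {n : ℕ} (S : Matrix (Fin n) (Fin n) ℝ) (ξ : Fin n → ℝ) :
    bform S ξ ξ = pairing (Matrix.vecMulVec ξ ξ) S := by
  rw [pairing_comm, pairing_vecMulVec]

lemma bform_add {n : ℕ} (S R : Matrix (Fin n) (Fin n) ℝ) (ξ : Fin n → ℝ) :
    bform (S + R) ξ ξ = bform S ξ ξ + bform R ξ ξ := by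
  simp only [bform_eq_pairing, pairing_add]

lemma bform_smul {n : ℕ} (r : ℝ) (S : Matrix (Fin n) (Fin n) ℝ) (ξ : Fin n → ℝ) :
    bform (r • S) ξ ξ = r * bform S ξ ξ := by
  simp only [bform_eq_pairing, pairing_smul]

lemma bform_one {n : ℕ} (ξ : Fin n → ℝ) : bform 1 ξ ξ = ξ ⬝ᵥ ξ := by
  simp [bform, Matrix.one_apply, dotProduct]

lemma bform_vecMulVec {n : ℕ} (p ξ : Fin n → ℝ) :
    bform (Matrix.vecMulVec p p) ξ ξ = (p ⬝ᵥ ξ) ^ 2 := by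
  simp only [bform, Matrix.vecMulVec_apply, dotProduct, sq, Finset.sum_mul_sum]
  exact Finset.sum_congr rfl fun i _ => Finset.sum_congr rfl fun j _ => by ring

lemma posSemidef_of_bform {n : ℕ} {A : Matrix (Fin n) (Fin n) ℝ} (hA : ∀ i j, A i j = A j i)
    (h : ∀ ξ, 0 ≤ bform A ξ ξ) : A.PosSemidef := by
  refine Matrix.PosSemidef.of_dotProduct_mulVec_nonneg ?_ fun ξ => ?_
  · ext i j
    simp [hA i j]
  · refine (h ξ).trans_eq ?_
    simp only [bform, dotProduct, Matrix.mulVec, Finset.mul_sum]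
    exact Finset.sum_congr rfl fun i _ => Finset.sum_congr rfl fun j _ => by simp; ring

lemma graphInv_symm {n : ℕ} (p : Fin n → ℝ) (i j : Fin n) : graphInv p i j = graphInv p j i := by
  simp [graphInv, eq_comm, mul_comm]

/-! ### Variational formula and near-monotonicity of the inverse metric. -/

/-- Completing the square in s: the inverse metric is the minimum over s of |ξ - s p|² + s². This
lets two inverse metrics be compared through trial values of s. -/
lemma bform_graphInv_le {n : ℕ} (p ξ : Fin n → ℝ) (s : ℝ) :
    bform (graphInv p) ξ ξ ≤ (ξ - s • p) ⬝ᵥ (ξ - s • p) + s ^ 2 := by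
  have hpos := one_add_sum_sq_pos p
  rw [bform_graphInv]
  rw [sum_sq_eq_dotProduct] at *
  simp only [sub_dotProduct, dotProduct_sub, smul_dotProduct, dotProduct_smul, smul_eq_mul,
    dotProduct_comm ξ p]
  set b := p ⬝ᵥ ξ
  set m := p ⬝ᵥ p
  have : 0 ≤ (b - s * (1 + m)) ^ 2 / (1 + m) := by positivity
  have h2 : (b - s * (1 + m)) ^ 2 / (1 + m) = b * b / (1 + m) - 2 * s * b + s ^ 2 * (1 + m) := by
    field_simp
    ring
  linarith

lemma bform_graphInv_eq {n : ℕ} (p ξ : Fin n → ℝ) : ∃ s : ℝ,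
    bform (graphInv p) ξ ξ = (ξ - s • p) ⬝ᵥ (ξ - s • p) + s ^ 2 := by
  have hpos := one_add_sum_sq_pos p
  refine ⟨p ⬝ᵥ ξ / (1 + ∑ i, p i ^ 2), ?_⟩
  rw [bform_graphInv]
  rw [sum_sq_eq_dotProduct] at *
  simp only [sub_dotProduct, dotProduct_sub, smul_dotProduct, dotProduct_smul, smul_eq_mul,
    dotProduct_comm ξ p]
  field_simp
  ring

lemma dotProduct_self_nonneg_real {n : ℕ} (p : Fin n → ℝ) : 0 ≤ p ⬝ᵥ p := by
  rw [← sum_sq_eq_dotProduct]; positivity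

lemma dotProduct_sq_le {n : ℕ} (p q : Fin n → ℝ) : (p ⬝ᵥ q) ^ 2 ≤ (p ⬝ᵥ p) * (q ⬝ᵥ q) := by
  simpa [dotProduct, sq] using Finset.sum_mul_sq_le_sq_mul_sq Finset.univ p q

lemma bform_graphInv_nonneg {n : ℕ} (p ξ : Fin n → ℝ) : 0 ≤ bform (graphInv p) ξ ξ := by
  obtain ⟨s, hs⟩ := bform_graphInv_eq p ξ
  rw [hs]
  have := dotProduct_self_nonneg_real (ξ - s • p)
  positivity

lemma posSemidef_graphInv {n : ℕ} (p : Fin n → ℝ) : (graphInv p).PosSemidef :=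
  posSemidef_of_bform (graphInv_symm p) (bform_graphInv_nonneg p)

/-- Almost-monotonicity of the inverse metric: if `a₁ p₁ = a₂ p₂ + h` with `a₁ ≤ a₂` and `h` small,
then `(1 - κ) g₁⁻¹ ≤ g₂⁻¹`. -/
lemma bform_graphInv_mono {n : ℕ} {p₁ p₂ h : Fin n → ℝ} {a₁ a₂ κ : ℝ} (ha₁ : 0 < a₁)
    (ha : a₁ ≤ a₂) (hκ : 0 < κ) (hκ1 : κ < 1) (hp : a₁ • p₁ = a₂ • p₂ + h)
    (hh : 2 * (h ⬝ᵥ h) ≤ κ ^ 2 * a₂ ^ 2) (ξ : Fin n → ℝ) :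
    (1 - κ) * bform (graphInv p₁) ξ ξ ≤ bform (graphInv p₂) ξ ξ := by
  obtain ⟨s, hs⟩ := bform_graphInv_eq p₂ ξ
  have ha₂ : 0 < a₂ := ha₁.trans_le ha
  -- This trial value turns s p₂ into a multiple of p₁ up to (s / a₂) h, and since a₁ ≤ a₂ its
  -- square is at most s².
  have h1 := bform_graphInv_le p₁ ξ (s / a₂ * a₁)
  have e1 : ξ - (s / a₂ * a₁) • p₁ = (ξ - s • p₂) - (s / a₂) • h := by
    rw [mul_smul, hp, smul_add, smul_smul, div_mul_cancel₀ _ ha₂.ne']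
    abel
  rw [e1] at h1
  set z := ξ - s • p₂
  set t := s / a₂
  have hst : s = t * a₂ := by simp only [t]; field_simp
  rw [hs, hst]
  simp only [sub_dotProduct, dotProduct_sub, smul_dotProduct, dotProduct_smul, smul_eq_mul,
    dotProduct_comm h z] at h1
  have hz := dotProduct_self_nonneg_real (κ • z + t • h)
  simp only [add_dotProduct, dotProduct_add, smul_dotProduct, dotProduct_smul, smul_eq_mul,
    dotProduct_comm h z] at hz
  have hzz := dotProduct_self_nonneg_real z
  have hhh := dotProduct_self_nonneg_real h
  set Z := z ⬝ᵥ z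
  set H := h ⬝ᵥ h
  set Y := z ⬝ᵥ h
  have b1 : (t * a₁) ^ 2 ≤ (t * a₂) ^ 2 := by
    rw [mul_pow, mul_pow]; gcongr
  have b2 : t ^ 2 * (2 * H) ≤ t ^ 2 * (κ ^ 2 * a₂ ^ 2) := by gcongr
  -- Young's inequality with weight κ on the cross term; everything is multiplied by κ to avoid
  -- dividing. The 2 in `hh` pays for 1 + κ ≤ 2.
  have key : bform (graphInv p₁) ξ ξ ≤ (1 + κ) * (Z + (t * a₂) ^ 2) := by
    have b3 : bform (graphInv p₁) ξ ξ ≤ Z - 2 * t * Y + t ^ 2 * H + (t * a₂) ^ 2 := by linarith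
    have b4 : κ * (-2 * t * Y) ≤ κ ^ 2 * Z + t ^ 2 * H := by linarith
    have b5 : t ^ 2 * H * (1 + κ) ≤ κ ^ 2 * (t * a₂) ^ 2 := by
      nlinarith [mul_nonneg (sq_nonneg t) hhh]
    have b6 : κ * bform (graphInv p₁) ξ ξ ≤ κ * ((1 + κ) * (Z + (t * a₂) ^ 2)) := by
      have := mul_le_mul_of_nonneg_left b3 hκ.le
      linarith
    exact le_of_mul_le_mul_left b6 hκ
  have h3 : (1 - κ) * bform (graphInv p₁) ξ ξ ≤ (1 - κ) * ((1 + κ) * (Z + (t * a₂) ^ 2)) :=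
    mul_le_mul_of_nonneg_left key (by linarith)
  have h4 : 0 ≤ κ ^ 2 * (Z + (t * a₂) ^ 2) := by positivity
  linarith

/-! ### The pointwise inequality at a maximum. -/

/-- Scalar bookkeeping: Xᵢⱼ stands for the trace of Sⱼ in gᵢ⁻¹, and σ, ν for g₁⁻¹ evaluated on p₁,
p₂. The proof adds (1 - κ) times `F₁` to a₂ times `F₂`. -/
lemma combine_trace_bounds {N a₁ a₂ c κ e θ σ ν X₁₁ X₁₂ X₂₂ : ℝ} (ha : 0 ≤ a₂ - a₁)
    (hκ : 0 ≤ κ) (hκ1 : κ ≤ 1) (hc : 0 ≤ c) (ha₂ : 0 ≤ a₂) (he : 0 ≤ e * N) (hθ : 0 ≤ θ)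
    (F₁ : a₁ * X₁₁ ≤ e * N + a₁ * σ + a₂ * X₁₂ - a₂ * ν)
    (F₂ : (1 - κ) * X₁₂ - X₂₂ ≤ c * (N - (1 - κ) * (N - σ + ν)))
    (G₁ : a₁ * σ - a₂ * ν ≤ (a₂ - a₁) + 2 * θ)
    (G₂ : a₂ * (σ - ν) ≤ 2 * (a₂ - a₁) + 2 * θ) :
    (1 - κ) * a₁ * X₁₁ - a₂ * X₂₂ ≤
      N * e + (2 * c + 1) * (a₂ - a₁) + 2 * (1 + c) * θ + κ * N * c * a₂ := by
  set R := e * N + ((a₂ - a₁) + 2 * θ) + c * (2 * (a₂ - a₁) + 2 * θ) with hR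
  have hR0 : 0 ≤ R := by positivity
  have hκR : 0 ≤ κ * R := by positivity
  calc (1 - κ) * a₁ * X₁₁ - a₂ * X₂₂
      = (1 - κ) * (a₁ * X₁₁ - a₂ * X₁₂) + a₂ * ((1 - κ) * X₁₂ - X₂₂) := by ring
    _ ≤ (1 - κ) * (e * N + a₁ * σ - a₂ * ν) + a₂ * (c * (N - (1 - κ) * (N - σ + ν))) := by
        refine add_le_add (mul_le_mul_of_nonneg_left (by linarith) (by linarith))
          (mul_le_mul_of_nonneg_left F₂ ha₂)
    _ = (1 - κ) * (e * N + (a₁ * σ - a₂ * ν) + c * (a₂ * (σ - ν))) + κ * N * c * a₂ := by ring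
    _ ≤ (1 - κ) * R + κ * N * c * a₂ := by
        refine add_le_add_left (mul_le_mul_of_nonneg_left ?_ (by linarith)) _
        rw [hR]
        gcongr
    _ ≤ R + κ * N * c * a₂ := by linarith
    _ = _ := by rw [hR]; ring

/-- The pointwise inequality behind the comparison principle: `pᵢ`, `Sᵢ` are the gradients and
Hessians of two functions `uᵢ` and `aᵢ = exp (-uᵢ)`. -/
lemma pairing_graphInv_sub_le {n : ℕ} {p₁ p₂ h : Fin n → ℝ} {S₁ S₂ : Matrix (Fin n) (Fin n) ℝ}
    {a₁ a₂ c κ e θ : ℝ} (ha₁ : 0 < a₁) (ha : a₁ ≤ a₂) (hc : 0 ≤ c) (hκ : 0 < κ) (hκ1 : κ < 1)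
    (he : 0 ≤ e) (hθ : 0 ≤ θ) (hp : a₁ • p₁ = a₂ • p₂ + h)
    (hh : 2 * (h ⬝ᵥ h) ≤ κ ^ 2 * a₂ ^ 2) (hhθ : h ⬝ᵥ h ≤ θ ^ 2)
    (hS : ∀ ξ, a₁ * (bform S₁ ξ ξ - (p₁ ⬝ᵥ ξ) ^ 2) - a₂ * (bform S₂ ξ ξ - (p₂ ⬝ᵥ ξ) ^ 2)
      ≤ e * (ξ ⬝ᵥ ξ))
    (hS₂ : ∀ ξ, -c * (ξ ⬝ᵥ ξ + (p₂ ⬝ᵥ ξ) ^ 2) ≤ bform S₂ ξ ξ) :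
    (1 - κ) * a₁ * pairing (graphInv p₁) S₁ - a₂ * pairing (graphInv p₂) S₂ ≤
      n * e + (2 * c + 1) * (a₂ - a₁) + 2 * (1 + c) * θ + κ * n * c * a₂ := by
  have ha₂ : 0 < a₂ := ha₁.trans_le ha
  -- The second-order condition traced with g₁⁻¹.
  have F1 := pairing_nonneg (posSemidef_graphInv p₁)
    (S := e • 1 + (-a₁) • S₁ + a₁ • Matrix.vecMulVec p₁ p₁ + a₂ • S₂
      + (-a₂) • Matrix.vecMulVec p₂ p₂) (by
    intro ξ
    simp only [bform_add, bform_smul, bform_one, bform_vecMulVec]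
    linarith [hS ξ])
  -- The only place where coefficients differ: g₂⁻¹ - (1 - κ)g₁⁻¹ ≥ 0 is paired with S₂ + c g₂ ≥ 0.
  have F2 := pairing_nonneg (A := graphInv p₂ + (-(1 - κ)) • graphInv p₁)
    (S := S₂ + c • (1 + Matrix.vecMulVec p₂ p₂)) (by
    refine posSemidef_of_bform (fun i j => ?_) fun ξ => ?_
    · simp [graphInv_symm _ i j]
    · simp only [bform_add, bform_smul]
      linarith [bform_graphInv_mono ha₁ ha hκ hκ1 hp hh ξ]) (by
    intro ξ
    simp only [bform_add, bform_smul, bform_one, bform_vecMulVec]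
    linarith [hS₂ ξ])
  rw [pairing_comm, pairing_add, pairing_smul, pairing_comm, pairing_comm _ (graphInv p₁)] at F2
  simp only [pairing_add, pairing_smul, pairing_vecMulVec, pairing_graphInv_one] at F1 F2
  set X₁₁ := pairing (graphInv p₁) S₁
  set X₁₂ := pairing (graphInv p₁) S₂
  set X₂₂ := pairing (graphInv p₂) S₂
  have hm := one_add_sum_sq_pos p₁
  have hm₂ := one_add_sum_sq_pos p₂
  set ν := bform (graphInv p₁) p₂ p₂ with hν
  have hν0 : 0 ≤ ν := bform_graphInv_nonneg _ _
  set σ := (p₁ ⬝ᵥ p₁) / (1 + ∑ i, p₁ i ^ 2) with hσ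
  have hσ0 : 0 ≤ σ := div_nonneg (dotProduct_self_nonneg_real _) hm.le
  have hσ1 : σ ≤ 1 := by
    rw [hσ, div_le_one hm, sum_sq_eq_dotProduct]; linarith
  have e1 : bform (graphInv p₁) p₁ p₁ = σ := by
    rw [bform_graphInv, hσ, sum_sq_eq_dotProduct]
    rw [sum_sq_eq_dotProduct] at hm
    field_simp
    ring
  have e2 : bform (graphInv p₂) p₂ p₂ = (p₂ ⬝ᵥ p₂) / (1 + ∑ i, p₂ i ^ 2) := by
    rw [bform_graphInv, sum_sq_eq_dotProduct]
    rw [sum_sq_eq_dotProduct] at hm₂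
    field_simp
    ring
  rw [e1] at F1
  rw [e2] at F2
  -- Expand g₁⁻¹ on a₂p₂ = a₁p₁ - h and drop the square of h; the cross term is at most θ because
  -- |p₁| ≤ 1 + |p₁|².
  have hN : a₁ ^ 2 * σ - 2 * a₁ * θ ≤ a₂ * (a₂ * ν) := by
    have hq : a₂ • p₂ = a₁ • p₁ - h := by rw [hp]; abel
    have hA : bform (graphInv p₁) (a₂ • p₂) (a₂ • p₂) = a₂ * (a₂ * ν) := by
      rw [hν, bform_graphInv, bform_graphInv]
      simp only [smul_dotProduct, dotProduct_smul, smul_eq_mul]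
      ring
    have hB : bform (graphInv p₁) (a₁ • p₁ - h) (a₁ • p₁ - h) =
        a₁ ^ 2 * σ - 2 * a₁ * (p₁ ⬝ᵥ h / (1 + ∑ i, p₁ i ^ 2)) + bform (graphInv p₁) h h := by
      rw [bform_graphInv, bform_graphInv, hσ]
      simp only [smul_dotProduct, dotProduct_smul, smul_eq_mul, sub_dotProduct, dotProduct_sub,
        dotProduct_comm h p₁]
      rw [sum_sq_eq_dotProduct] at hm ⊢
      field_simp
      ring
    rw [← hA, hq, hB]
    have hb : p₁ ⬝ᵥ h / (1 + ∑ i, p₁ i ^ 2) ≤ θ := by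
      rw [div_le_iff₀ hm]
      refine abs_le_of_sq_le_sq' ?_ (by positivity) |>.2
      refine (dotProduct_sq_le p₁ h).trans ?_
      rw [sum_sq_eq_dotProduct] at hm ⊢
      have hpp := dotProduct_self_nonneg_real p₁
      calc (p₁ ⬝ᵥ p₁) * (h ⬝ᵥ h) ≤ (1 + p₁ ⬝ᵥ p₁) ^ 2 * θ ^ 2 := by
            gcongr
            · exact dotProduct_self_nonneg_real h
            · nlinarith
        _ = _ := by ring
    have := bform_graphInv_nonneg p₁ h
    nlinarith
  have G1 : a₁ * σ - a₂ * ν ≤ (a₂ - a₁) + 2 * θ := by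
    refine le_of_mul_le_mul_left ?_ ha₂
    have t1 : 0 ≤ (a₂ - a₁) * θ := mul_nonneg (by linarith) hθ
    have t2 : a₁ * σ * (a₂ - a₁) ≤ a₂ * (a₂ - a₁) := by
      refine mul_le_mul_of_nonneg_right ?_ (by linarith)
      nlinarith
    linarith
  have G2 : a₂ * (σ - ν) ≤ 2 * (a₂ - a₁) + 2 * θ := by
    refine le_of_mul_le_mul_left ?_ ha₂
    have t1 : 0 ≤ (a₂ - a₁) * θ := mul_nonneg (by linarith) hθ
    have t2 : (a₂ + a₁) * (a₂ - a₁) * σ ≤ 2 * a₂ * (a₂ - a₁) := by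
      have : 0 ≤ (a₂ + a₁) * (a₂ - a₁) := mul_nonneg (by linarith) (by linarith)
      nlinarith [mul_nonneg (sub_nonneg.2 ha) (sub_nonneg.2 ha)]
    linarith
  have F1' : a₁ * X₁₁ ≤ e * n + a₁ * σ + a₂ * X₁₂ - a₂ * ν := by nlinarith [mul_nonneg he hσ0]
  have F2' : (1 - κ) * X₁₂ - X₂₂ ≤ c * (n - (1 - κ) * (n - σ + ν)) := by linarith
  exact combine_trace_bounds (by linarith) hκ.le hκ1.le hc ha₂.le (by positivity) hθ
    F1' F2' G1 G2

/-! ### Consequences of the curvature bound. -/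

/-- A lower Hessian bound `S ≥ -c g` bounds the trace `g^{ij} S_{ij}` from below. -/
lemma le_pairing_graphInv {n : ℕ} {p : Fin n → ℝ} {S : Matrix (Fin n) (Fin n) ℝ} {c : ℝ}
    (hS : ∀ ξ, -c * (ξ ⬝ᵥ ξ + (p ⬝ᵥ ξ) ^ 2) ≤ bform S ξ ξ) :
    -c * n ≤ pairing (graphInv p) S := by
  have F := pairing_nonneg (posSemidef_graphInv p)
    (S := S + c • (1 + Matrix.vecMulVec p p)) (by
    intro ξ
    simp only [bform_add, bform_smul, bform_one, bform_vecMulVec]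
    linarith [hS ξ])
  simp only [pairing_add, pairing_smul, pairing_vecMulVec, pairing_graphInv_one] at F
  have hm := one_add_sum_sq_pos p
  have e2 : bform (graphInv p) p p = (p ⬝ᵥ p) / (1 + ∑ i, p i ^ 2) := by
    rw [bform_graphInv, sum_sq_eq_dotProduct]
    rw [sum_sq_eq_dotProduct] at hm
    field_simp
    ring
  rw [e2] at F
  linarith

lemma metric_mul_invMetric {n : ℕ} (f : E n → ℝ) (x : E n) :
    metric f x * invMetric f x = 1 := by
  have hm : 0 < 1 + gradSq f x := one_add_sum_sq_pos fun i => pd i f x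
  ext i j
  rw [Matrix.mul_apply]
  simp only [metric, invMetric, Matrix.of_apply, Matrix.one_apply]
  have : ∀ k, ((if i = k then 1 else 0) + pd i f x * pd k f x) *
      ((if k = j then 1 else 0) - pd k f x * pd j f x / (1 + gradSq f x)) =
      (if i = k then (if k = j then 1 else 0) - pd k f x * pd j f x / (1 + gradSq f x) else 0)
      + (if k = j then pd i f x * pd k f x else 0)
      - pd k f x ^ 2 * (pd i f x * pd j f x / (1 + gradSq f x)) := by
    intro k
    split_ifs <;> ring
  simp only [this, Finset.sum_sub_distrib, Finset.sum_add_distrib, ← Finset.sum_mul,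
    Finset.sum_ite_eq, Finset.sum_ite_eq', Finset.mem_univ, if_true]
  change _ - gradSq f x * _ = _
  field_simp
  ring

/-- The curvature bound is the lower Hessian bound `D²f ≥ -c (I + Df ⊗ Df)`. -/
lemma CurvBoundAt.le_bform_hess {n : ℕ} {c : ℝ} {f : E n → ℝ} {x : E n} (h : CurvBoundAt c f x)
    (ξ : Fin n → ℝ) :
    -c * (ξ ⬝ᵥ ξ + ((fun i => pd i f x) ⬝ᵥ ξ) ^ 2) ≤ bform (hess f x) ξ ξ := by
  have hv : 0 < gradFun f x := Real.sqrt_pos.2 (one_add_sum_sq_pos fun i => pd i f x)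
  have h1 := h ξ
  rw [shapeOp, smul_smul, mul_inv_cancel₀ hv.ne', one_smul, Matrix.mulVec_mulVec,
    ← Matrix.mul_assoc, metric_mul_invMetric, Matrix.one_mul] at h1
  have e1 : ξ ⬝ᵥ (hess f x *ᵥ ξ) = bform (hess f x) ξ ξ := by
    simp only [bform, dotProduct, Matrix.mulVec, Finset.mul_sum]
    exact Finset.sum_congr rfl fun i _ => Finset.sum_congr rfl fun j _ => by ring
  have e2 : ξ ⬝ᵥ (metric f x *ᵥ ξ) = ξ ⬝ᵥ ξ + ((fun i => pd i f x) ⬝ᵥ ξ) ^ 2 := by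
    have : metric f x = 1 + Matrix.vecMulVec (fun i => pd i f x) (fun i => pd i f x) := by
      ext i j
      simp [metric, Matrix.one_apply, Matrix.vecMulVec_apply]
    rw [← bform_one, ← bform_vecMulVec, ← bform_add, ← this]
    simp only [bform, dotProduct, Matrix.mulVec, Finset.mul_sum]
    exact Finset.sum_congr rfl fun i _ => Finset.sum_congr rfl fun j _ => by ring
  rwa [e1, e2] at h1

/-! ### First and second order conditions at maxima. -/

/-- The second-derivative necessary condition at a local maximum. -/
lemma hasDerivAt_zero_and_nonpos_of_isLocalMax {g g' : ℝ → ℝ} {g'' : ℝ}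
    (hg : ∀ s, HasDerivAt g (g' s) s) (hg' : HasDerivAt g' g'' 0) (hmax : IsLocalMax g 0) :
    g' 0 = 0 ∧ g'' ≤ 0 := by
  have h0 : g' 0 = 0 := hmax.hasDerivAt_eq_zero (hg 0)
  refine ⟨h0, ?_⟩
  by_contra! hpos
  have hd : deriv g = g' := funext fun s => (hg s).deriv
  -- A positive second derivative would make 0 also a local minimum, so g would be locally constant.
  have hmin : IsLocalMin g 0 := isLocalMin_of_deriv_deriv_pos (by rwa [hd, hg'.deriv])
    (by rw [hd, h0]) (hg 0).continuousAt
  have hconst : g =ᶠ[𝓝 0] fun _ => g 0 := by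
    filter_upwards [hmax, hmin] with s h1 h2 using le_antisymm h1 h2
  have : deriv (deriv g) 0 = 0 := by
    rw [hconst.deriv.deriv_eq]
    simp
  rw [hd, hg'.deriv] at this
  exact hpos.ne' this

lemma fderiv_eq_sum_pd {n : ℕ} (f : E n → ℝ) (x : E n) (ξ : Fin n → ℝ) :
    fderiv ℝ f x (WithLp.toLp 2 ξ) = (fun i => pd i f x) ⬝ᵥ ξ := by
  have h : (WithLp.toLp 2 ξ : E n) = ∑ i, ξ i • EuclideanSpace.single i (1 : ℝ) := by
    ext j
    simp [Finset.sum_apply, Pi.single_apply]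
  rw [h, map_sum]
  simp [pd, dotProduct, mul_comm]

lemma hasDerivAt_line {n : ℕ} {f : E n → ℝ} (hf : Differentiable ℝ f) (x : E n) (ξ : Fin n → ℝ)
    (s : ℝ) : HasDerivAt (fun s : ℝ => f (x + s • WithLp.toLp 2 ξ))
      ((fun i => pd i f (x + s • WithLp.toLp 2 ξ)) ⬝ᵥ ξ) s := by
  rw [← fderiv_eq_sum_pd]
  have h1 : HasDerivAt (fun s : ℝ => x + s • (WithLp.toLp 2 ξ : E n)) (WithLp.toLp 2 ξ) s := by
    simpa using ((hasDerivAt_id s).smul_const (WithLp.toLp 2 ξ : E n)).const_add x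
  exact (hf _).hasFDerivAt.comp_hasDerivAt s h1

lemma contDiff_pd {n : ℕ} {f : E n → ℝ} (hf : ContDiff ℝ ∞ f) (i : Fin n) :
    ContDiff ℝ ∞ (pd i f) :=
  (hf.fderiv_right (m := ∞) (by simp)).clm_apply contDiff_const

lemma hasDerivAt_line_pd {n : ℕ} {f : E n → ℝ} (hf : ContDiff ℝ ∞ f) (x : E n) (ξ : Fin n → ℝ)
    (s : ℝ) : HasDerivAt (fun s : ℝ => (fun i => pd i f (x + s • WithLp.toLp 2 ξ)) ⬝ᵥ ξ)
      (bform (hess f (x + s • WithLp.toLp 2 ξ)) ξ ξ) s := by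
  have h : ∀ i ∈ Finset.univ, HasDerivAt (fun s : ℝ => pd i f (x + s • WithLp.toLp 2 ξ) * ξ i)
      (((fun j => pd j (pd i f) (x + s • WithLp.toLp 2 ξ)) ⬝ᵥ ξ) * ξ i) s := fun i _ =>
    (hasDerivAt_line ((contDiff_pd hf i).differentiable (by simp)) x ξ s).mul_const _
  refine (HasDerivAt.fun_sum h).congr_deriv ?_
  simp only [bform, hess, Matrix.of_apply, dotProduct, Finset.sum_mul]
  rw [Finset.sum_comm]
  exact Finset.sum_congr rfl fun i _ => Finset.sum_congr rfl fun j _ => by ring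

/-- First and second order conditions at a maximum of `exp (-f₂) - exp (-f₁) - ε |y|²`. -/
lemma spatial_max_conditions {n : ℕ} {f₁ f₂ : E n → ℝ} (hf₁ : ContDiff ℝ ∞ f₁)
    (hf₂ : ContDiff ℝ ∞ f₂) {ε : ℝ} {x : E n}
    (hmax : ∀ y, Real.exp (-f₂ y) - Real.exp (-f₁ y) - ε * ∑ i, y i ^ 2 ≤
      Real.exp (-f₂ x) - Real.exp (-f₁ x) - ε * ∑ i, x i ^ 2) :
    (Real.exp (-f₁ x) • (fun i => pd i f₁ x) =
      Real.exp (-f₂ x) • (fun i => pd i f₂ x) + (2 * ε) • (fun i => x i)) ∧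
    ∀ ξ, Real.exp (-f₁ x) * (bform (hess f₁ x) ξ ξ - ((fun i => pd i f₁ x) ⬝ᵥ ξ) ^ 2)
      - Real.exp (-f₂ x) * (bform (hess f₂ x) ξ ξ - ((fun i => pd i f₂ x) ⬝ᵥ ξ) ^ 2)
      ≤ 2 * ε * (ξ ⬝ᵥ ξ) := by
  have key : ∀ ξ : Fin n → ℝ,
      Real.exp (-f₁ x) * ((fun i => pd i f₁ x) ⬝ᵥ ξ) - Real.exp (-f₂ x) * ((fun i => pd i f₂ x) ⬝ᵥ ξ)
        - 2 * ε * ((fun i => x i) ⬝ᵥ ξ) = 0 ∧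
      Real.exp (-f₁ x) * (bform (hess f₁ x) ξ ξ - ((fun i => pd i f₁ x) ⬝ᵥ ξ) ^ 2)
      - Real.exp (-f₂ x) * (bform (hess f₂ x) ξ ξ - ((fun i => pd i f₂ x) ⬝ᵥ ξ) ^ 2)
      - 2 * ε * (ξ ⬝ᵥ ξ) ≤ 0 := by
    intro ξ
    have A : ∀ f : E n → ℝ, ContDiff ℝ ∞ f → ∀ s : ℝ,
        HasDerivAt (fun s : ℝ => Real.exp (-f (x + s • WithLp.toLp 2 ξ)))
          (-(Real.exp (-f (x + s • WithLp.toLp 2 ξ)) *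
            ((fun i => pd i f (x + s • WithLp.toLp 2 ξ)) ⬝ᵥ ξ))) s := by
      intro f hf s
      refine ((hasDerivAt_line (hf.differentiable (by simp)) x ξ s).fun_neg.exp).congr_deriv ?_
      ring
    have B : ∀ f : E n → ℝ, ContDiff ℝ ∞ f →
        HasDerivAt (fun s : ℝ => -(Real.exp (-f (x + s • WithLp.toLp 2 ξ)) *
            ((fun i => pd i f (x + s • WithLp.toLp 2 ξ)) ⬝ᵥ ξ)))
          (-(Real.exp (-f x) * (bform (hess f x) ξ ξ - ((fun i => pd i f x) ⬝ᵥ ξ) ^ 2))) 0 := by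
      intro f hf
      refine ((A f hf 0).fun_mul (hasDerivAt_line_pd hf x ξ 0)).fun_neg.congr_deriv ?_
      simp only [zero_smul, add_zero]
      ring
    have C : ∀ s : ℝ, HasDerivAt (fun s : ℝ => ε * ∑ i, (x + s • WithLp.toLp 2 ξ : E n) i ^ 2)
        (ε * ∑ i, 2 * (x i + s * ξ i) * ξ i) s := by
      intro s
      refine (HasDerivAt.fun_sum fun i _ => ?_).const_mul ε
      have : HasDerivAt (fun s : ℝ => x i + s * ξ i) (ξ i) s := by
        simpa using ((hasDerivAt_id s).mul_const (ξ i)).const_add (x i)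
      simpa using this.fun_pow 2
    have D : HasDerivAt (fun s : ℝ => ε * ∑ i, 2 * (x i + s * ξ i) * ξ i)
        (2 * ε * (ξ ⬝ᵥ ξ)) 0 := by
      have : HasDerivAt (fun s : ℝ => ε * ∑ i, 2 * (x i + s * ξ i) * ξ i)
          (ε * ∑ i, 2 * ξ i * ξ i) 0 := by
        refine (HasDerivAt.fun_sum fun i _ => ?_).const_mul ε
        have : HasDerivAt (fun s : ℝ => x i + s * ξ i) (ξ i) 0 := by
          simpa using ((hasDerivAt_id (0 : ℝ)).mul_const (ξ i)).const_add (x i)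
        exact (this.const_mul 2).mul_const _
      refine this.congr_deriv ?_
      simp only [dotProduct, Finset.mul_sum]
      exact Finset.sum_congr rfl fun i _ => by ring
    obtain ⟨h1, h2⟩ := hasDerivAt_zero_and_nonpos_of_isLocalMax
      (fun s => ((A f₂ hf₂ s).fun_sub (A f₁ hf₁ s)).fun_sub (C s))
      (((B f₂ hf₂).fun_sub (B f₁ hf₁)).fun_sub D)
      (Eventually.of_forall fun s => by simpa using hmax (x + s • WithLp.toLp 2 ξ))
    refine ⟨?_, by linarith⟩
    simp only [zero_smul, add_zero, zero_mul] at h1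
    have e : ε * ∑ i, 2 * x i * ξ i = 2 * ε * ((fun i => x i) ⬝ᵥ ξ) := by
      simp only [dotProduct, Finset.mul_sum]
      exact Finset.sum_congr rfl fun i _ => by ring
    rw [e] at h1
    linarith
  refine ⟨?_, fun ξ => by linarith [(key ξ).2]⟩
  ext j
  -- Basis directions recover the vector identity from its directional versions.
  have h := (key (Pi.single j 1)).1
  simp only [dotProduct_single, mul_one] at h
  simp only [Pi.smul_apply, Pi.add_apply, smul_eq_mul]
  linarith

/-- Only the backward direction t/2 - t is tested, so t = T is allowed. -/
lemma deriv_nonneg_of_isMaxOn_Ioc {f : ℝ → ℝ} {f' t T : ℝ} (ht : t ∈ Ioc 0 T)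
    (hf : HasDerivWithinAt f f' (Ioc 0 T) t) (hmax : IsMaxOn f (Ioc 0 T) t) : 0 ≤ f' := by
  have hcone : t / 2 - t ∈ posTangentConeAt (Ioc 0 T) t := by
    refine sub_mem_posTangentConeAt_of_segment_subset ((convex_Ioc 0 T).segment_subset ht ?_)
    exact ⟨by linarith [ht.1], by linarith [ht.1, ht.2]⟩
  have h := hmax.localize.hasFDerivWithinAt_nonpos hf.hasFDerivWithinAt hcone
  have h' : (t / 2 - t) * f' ≤ 0 := by simpa using h
  nlinarith [ht.1]

/-! ### Time monotonicity and continuity up to the initial time. -/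

namespace IsSmoothSolution

variable {n : ℕ} {T : ℝ} {u₀ : E n → ℝ} {u : E n → ℝ → ℝ}

lemma contDiff_slice (hu : IsSmoothSolution T u₀ u) {t : ℝ} (ht : t ∈ Ioc 0 T) :
    ContDiff ℝ ∞ fun y => u y t := by
  rw [← contDiffOn_univ]
  exact hu.smooth.comp (f := fun y : E n => (y, t)) (by fun_prop) fun y _ => ⟨mem_univ _, ht⟩

lemma hasDerivWithinAt (hu : IsSmoothSolution T u₀ u) {t : ℝ} (ht : t ∈ Ioc 0 T) (x : E n) :
    HasDerivWithinAt (fun s => u x s)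
      (pairing (graphInv fun i => pd i (fun y => u y t) x) (hess (fun y => u y t) x))
      (Ioc 0 T) t := by
  have h : ContDiffOn ℝ ∞ (fun s => u x s) (Ioc 0 T) :=
    hu.smooth.comp (f := fun s : ℝ => (x, s)) (by fun_prop) fun s hs => ⟨mem_univ _, hs⟩
  have h2 := ((h.differentiableOn (by simp)) t ht).hasDerivWithinAt
  rw [hu.eqn t ht x] at h2
  exact h2

lemma tendsto_initial (hu : IsSmoothSolution T u₀ u) (x : E n) :
    Tendsto (fun t => u x t) (𝓝[>] 0) (𝓝 (u₀ x)) :=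
  (tendstoLocallyUniformlyOn_univ.2 hu.initial).tendsto_at (mem_univ x)

/-- Under the curvature bound, `u + n c t` is nondecreasing in time. -/
lemma initial_sub_le (hu : IsSmoothSolution T u₀ u) {c : ℝ}
    (hc : ∀ t ∈ Ioc 0 T, ∀ x, CurvBoundAt c (fun y => u y t) x) {t : ℝ} (ht : t ∈ Ioc 0 T)
    (x : E n) : u₀ x - c * n * t ≤ u x t := by
  have hd : ∀ s ∈ Ioc 0 T, HasDerivWithinAt (fun s => u x s + c * n * s)
      (pairing (graphInv fun i => pd i (fun y => u y s) x) (hess (fun y => u y s) x) + c * n)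
      (Ioc 0 T) s := fun s hs =>
    (hu.hasDerivWithinAt hs x).fun_add
      (by simpa using ((hasDerivAt_id s).const_mul (c * n)).hasDerivWithinAt)
  have hmono : MonotoneOn (fun s => u x s + c * n * s) (Ioc 0 T) := by
    refine monotoneOn_of_hasDerivWithinAt_nonneg (convex_Ioc 0 T)
      (fun s hs => (hd s hs).continuousWithinAt)
      (fun s hs => (hd s (interior_subset hs)).mono interior_subset) fun s hs => ?_
    have := le_pairing_graphInv fun ξ => (hc s (interior_subset hs) x).le_bform_hess ξ
    linarith
  have hlim : Tendsto (fun s => u x s + c * n * s) (𝓝[>] 0) (𝓝 (u₀ x + c * n * 0)) :=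
    (hu.tendsto_initial x).add
      ((tendsto_const_nhds.mul tendsto_id).mono_left nhdsWithin_le_nhds)
  have := le_of_tendsto hlim (b := u x t + c * n * t) (by
    filter_upwards [Ioc_mem_nhdsGT ht.1] with s hs
    exact hmono ⟨hs.1, hs.2.trans ht.2⟩ ht hs.2)
  linarith

end IsSmoothSolution

/-- The extension of `u` to `t ≤ 0` by the initial data. -/
def extendInitial {n : ℕ} (u₀ : E n → ℝ) (u : E n → ℝ → ℝ) (p : E n × ℝ) : ℝ :=
  if p.2 ≤ 0 then u₀ p.1 else u p.1 p.2

lemma extendInitial_of_pos {n : ℕ} (u₀ : E n → ℝ) (u : E n → ℝ → ℝ) (x : E n) {t : ℝ}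
    (ht : 0 < t) : extendInitial u₀ u (x, t) = u x t := by
  simp [extendInitial, ht.not_ge]

lemma extendInitial_zero {n : ℕ} (u₀ : E n → ℝ) (u : E n → ℝ → ℝ) (x : E n) :
    extendInitial u₀ u (x, 0) = u₀ x := by
  simp [extendInitial]

/-- Locally uniform convergence to a continuous limit is joint convergence as (y, t) → (x, 0⁺).
Continuity on the closed slab supplies the maximum in the comparison argument. -/
lemma IsSmoothSolution.continuousOn_extendInitial {n : ℕ} {T : ℝ} {u₀ : E n → ℝ}
    {u : E n → ℝ → ℝ} (hu : IsSmoothSolution T u₀ u) (h₀ : Continuous u₀) :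
    ContinuousOn (extendInitial u₀ u) (univ ×ˢ Icc 0 T) := by
  rintro ⟨x, t⟩ ⟨-, ht⟩
  rcases ht.1.eq_or_lt with rfl | hpos
  · have hU : Tendsto (fun y : ℝ × E n => u y.2 y.1) (𝓝[>] 0 ×ˢ 𝓝 x) (𝓝 (u₀ x)) := by
      have h1 := tendstoLocallyUniformly_iff_forall_tendsto.1 hu.initial x
      have h2 : Tendsto (fun y : ℝ × E n => u₀ y.2) (𝓝[>] 0 ×ˢ 𝓝 x) (𝓝 (u₀ x)) :=
        (h₀.tendsto x).comp tendsto_snd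
      exact h2.congr_uniformity h1
    have hV : Tendsto (fun p : E n × ℝ => u p.1 p.2) (𝓝 x ×ˢ 𝓝[>] 0) (𝓝 (u₀ x)) :=
      hU.comp (tendsto_snd.prodMk tendsto_fst)
    rw [ContinuousWithinAt, extendInitial_zero]
    intro s hs
    have h3 : ∀ᶠ p in 𝓝 (x, (0 : ℝ)), u₀ p.1 ∈ s :=
      (h₀.comp continuous_fst).continuousAt.eventually hs
    have h4 : ∀ᶠ p in 𝓝 (x, (0 : ℝ)), 0 < p.2 → u p.1 p.2 ∈ s := by
      have h5 := hV.eventually hs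
      have h6 : 𝓝 x ×ˢ 𝓝[>] (0 : ℝ) = 𝓝 (x, (0 : ℝ)) ⊓ 𝓟 {p | 0 < p.2} := by
        rw [← nhdsWithin_univ x, ← nhdsWithin_prod_eq, nhdsWithin]
        congr 2
        ext p
        simp
      rw [h6, eventually_inf_principal] at h5
      exact h5
    refine mem_map.2 (mem_nhdsWithin_of_mem_nhds ?_)
    filter_upwards [h3, h4] with p hp3 hp4
    simp only [mem_preimage, extendInitial]
    split_ifs with hp
    · exact hp3
    · exact hp4 (not_le.1 hp)
  · have h1 : ContinuousWithinAt (fun p : E n × ℝ => u p.1 p.2) (univ ×ˢ Ioc 0 T) (x, t) :=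
      hu.smooth.continuousOn (x, t) ⟨mem_univ _, hpos, ht.2⟩
    have hnhds : {p : E n × ℝ | 0 < p.2} ∈ 𝓝 (x, t) :=
      (isOpen_lt continuous_const continuous_snd).mem_nhds hpos
    have h2 : ContinuousWithinAt (fun p : E n × ℝ => u p.1 p.2) (univ ×ˢ Icc 0 T) (x, t) := by
      refine h1.mono_of_mem_nhdsWithin ?_
      filter_upwards [self_mem_nhdsWithin, mem_nhdsWithin_of_mem_nhds hnhds] with p hp hp0
      exact ⟨mem_univ _, hp0, hp.2.2⟩
    refine h2.congr_of_eventuallyEq ?_ (extendInitial_of_pos u₀ u x hpos)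
    filter_upwards [mem_nhdsWithin_of_mem_nhds hnhds] with p hp
    exact extendInitial_of_pos u₀ u p.1 hp

/-! ### The comparison principle. -/

section Comparison

variable {n : ℕ} {T : ℝ} {u₀ : E n → ℝ} {u₁ u₂ : E n → ℝ → ℝ}

lemma mul_mem_Ioc {κ t : ℝ} (hκ0 : 0 ≤ κ) (hκ : κ < 1) (ht : t ∈ Ioc 0 T) :
    (1 - κ) * t ∈ Ioc 0 T :=
  ⟨mul_pos (by linarith) ht.1, by nlinarith [ht.1, ht.2]⟩

/-- Comparison of `exp (-u₂)` with the slowed-down `exp (-u₁)`, with a penalty at infinity. -/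
lemma exp_sub_exp_le_penalty (hu₁ : IsSmoothSolution T u₀ u₁) (hu₂ : IsSmoothSolution T u₀ u₂)
    (h₀ : Continuous u₀) {c A κ δ ε : ℝ} (hc : 0 ≤ c)
    (hc₂ : ∀ t ∈ Ioc 0 T, ∀ x, CurvBoundAt c (fun y => u₂ y t) x)
    (hA : ∀ t ∈ Ioc 0 T, ∀ x, Real.exp (-u₂ x t) ≤ A) (hκ : 0 < κ) (hκ1 : κ < 1) (hδ : 0 < δ)
    (hε : 0 < ε) (hT : 0 < T)
    (hsmall : 2 * (2 * Real.exp ((2 * c + 1) * T) * √(ε * A)) ^ 2 ≤ κ ^ 2 * δ ^ 2)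
    (hsmall' : n * (2 * (ε * Real.exp ((2 * c + 1) * T)))
      + 2 * (1 + c) * (2 * Real.exp ((2 * c + 1) * T) * √(ε * A)) + κ * n * c * A < δ)
    {t : ℝ} (ht : t ∈ Ioc 0 T) (x : E n) :
    Real.exp (-(2 * c + 1) * t) * (Real.exp (-u₂ x t) - Real.exp (-u₁ x ((1 - κ) * t))) ≤
      ε * ∑ i, x i ^ 2 + δ * (1 + t) := by
  by_contra! hbad
  set K := 2 * c + 1 with hK
  have hK0 : 0 < K := by positivity
  set M := Real.exp (K * T) with hM
  have hApos : 0 < A := (Real.exp_pos _).trans_le (hA t ht x)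
  set U₁ := extendInitial u₀ u₁
  set U₂ := extendInitial u₀ u₂
  -- The exponential absorbs K(a₂ - a₁). The constant δ makes G negative initially and forces a₂ -
  -- a₁ ≥ δ where G ≥ 0; δt makes the final inequality strict.
  let G : E n × ℝ → ℝ := fun p => Real.exp (-K * p.2) *
    (Real.exp (-U₂ p) - Real.exp (-U₁ (p.1, (1 - κ) * p.2))) -
      ε * ∑ i, p.1 i ^ 2 - δ * (1 + p.2)
  have hGpos : ∀ y : E n, ∀ s ∈ Ioc 0 T, G (y, s) = Real.exp (-K * s) *
      (Real.exp (-u₂ y s) - Real.exp (-u₁ y ((1 - κ) * s))) -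
      ε * ∑ i, y i ^ 2 - δ * (1 + s) := by
    intro y s hs
    simp only [G, U₁, U₂]
    rw [extendInitial_of_pos _ _ _ hs.1,
      extendInitial_of_pos _ _ _ (mul_mem_Ioc hκ.le hκ1 hs).1]
  have hGzero : ∀ y : E n, G (y, 0) < 0 := by
    intro y
    simp only [G, U₁, U₂, mul_zero, extendInitial_zero, sub_self]
    have : 0 ≤ ε * ∑ i, y i ^ 2 := by positivity
    linarith
  have hGcont : ContinuousOn G (univ ×ˢ Icc 0 T) := by
    have c1 := hu₁.continuousOn_extendInitial h₀
    have c2 := hu₂.continuousOn_extendInitial h₀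
    have c3 : ContinuousOn (fun p : E n × ℝ => U₁ (p.1, (1 - κ) * p.2)) (univ ×ˢ Icc 0 T) := by
      refine c1.comp (f := fun p : E n × ℝ => (p.1, (1 - κ) * p.2)) (by fun_prop) ?_
      rintro ⟨y, s⟩ ⟨-, hs⟩
      exact ⟨mem_univ _, mul_nonneg (by linarith) hs.1, by nlinarith [hs.1, hs.2]⟩
    have c4 : Continuous fun p : E n × ℝ => Real.exp (-K * p.2) := by fun_prop
    have c5 : Continuous fun p : E n × ℝ => ε * ∑ i, p.1 i ^ 2 := by fun_prop
    have c6 : Continuous fun p : E n × ℝ => δ * (1 + p.2) := by fun_prop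
    exact ((c4.continuousOn.mul ((Real.continuous_exp.comp_continuousOn c2.neg).sub
      (Real.continuous_exp.comp_continuousOn c3.neg))).sub c5.continuousOn).sub c6.continuousOn
  have hexp1 : ∀ s ∈ Ioc 0 T, Real.exp (-K * s) ≤ 1 := fun s hs =>
    Real.exp_le_one_iff.2 (by nlinarith [hs.1])
  -- where `G` is nonnegative
  have hloc : ∀ y : E n, ∀ s ∈ Ioc 0 T, 0 ≤ G (y, s) →
      δ ≤ Real.exp (-u₂ y s) - Real.exp (-u₁ y ((1 - κ) * s)) ∧ ε * ∑ i, y i ^ 2 ≤ A := by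
    intro y s hs hG
    rw [hGpos y s hs] at hG
    have e1 := hexp1 s hs
    have e0 := Real.exp_pos (-K * s)
    have e2 : 0 ≤ ε * ∑ i, y i ^ 2 := by positivity
    have e3 : 0 ≤ δ * s := mul_nonneg hδ.le hs.1.le
    have e4 := hA s hs y
    have e5 := Real.exp_pos (-u₁ y ((1 - κ) * s))
    set W := Real.exp (-u₂ y s) - Real.exp (-u₁ y ((1 - κ) * s)) with hW
    have hW0 : 0 < W := by
      by_contra! hneg
      nlinarith
    have hWle : Real.exp (-K * s) * W ≤ W := mul_le_of_le_one_left hW0.le e1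
    constructor <;> nlinarith
  set R := √(A / ε)
  have hball : ∀ y : E n, ∀ s ∈ Icc 0 T, 0 ≤ G (y, s) →
      (y, s) ∈ Metric.closedBall (0 : E n) R ×ˢ Icc 0 T := by
    intro y s hs hG
    refine ⟨?_, hs⟩
    have hs0 : 0 < s := by
      rcases hs.1.eq_or_lt with rfl | h
      · exact absurd hG (hGzero y).not_ge
      · exact h
    have := (hloc y s ⟨hs0, hs.2⟩ hG).2
    rw [mem_closedBall_zero_iff]
    refine Real.le_sqrt_of_sq_le ?_
    rw [EuclideanSpace.real_norm_sq_eq, le_div_iff₀ hε]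
    linarith
  have hGt : 0 < G (x, t) := by
    rw [hGpos x t ht]; linarith
  obtain ⟨⟨z, τ⟩, hzτ, hmax⟩ := ((isCompact_closedBall (0 : E n) R).prod
    (isCompact_Icc (a := (0 : ℝ)) (b := T))).exists_isMaxOn
    ⟨(x, t), hball x t ⟨ht.1.le, ht.2⟩ hGt.le⟩
    (hGcont.mono (prod_mono (subset_univ _) subset_rfl))
  have hGz : 0 < G (z, τ) := hGt.trans_le (hmax (hball x t ⟨ht.1.le, ht.2⟩ hGt.le))
  have hmax' : ∀ y : E n, ∀ s ∈ Icc 0 T, G (y, s) ≤ G (z, τ) := by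
    intro y s hs
    rcases le_total 0 (G (y, s)) with h | h
    · exact hmax (hball y s hs h)
    · exact h.trans hGz.le
  have hτ : τ ∈ Ioc 0 T := by
    refine ⟨?_, hzτ.2.2⟩
    rcases hzτ.2.1.eq_or_lt with h | h
    · have := hGzero z
      simp only at h
      rw [← h] at hGz
      linarith
    · exact h
  have hτ' := mul_mem_Ioc hκ.le hκ1 hτ
  obtain ⟨hWδ, hzA⟩ := hloc z τ hτ hGz.le
  -- spatial conditions
  set ε' := ε * Real.exp (K * τ) with hε'
  have hε'pos : 0 < ε' := by positivity
  have hε'M : ε' ≤ ε * M := by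
    rw [hε', hM]
    gcongr
    exact hτ.2
  have hsp := spatial_max_conditions (hu₁.contDiff_slice hτ') (hu₂.contDiff_slice hτ) (ε := ε')
    (x := z) (by
      intro y
      have h := hmax' y τ ⟨hτ.1.le, hτ.2⟩
      rw [hGpos y τ hτ, hGpos z τ hτ] at h
      have h2 := mul_le_mul_of_nonneg_left
        (by linarith : Real.exp (-K * τ) *
          (Real.exp (-u₂ y τ) - Real.exp (-u₁ y ((1 - κ) * τ))) - ε * ∑ i, y i ^ 2 ≤
          Real.exp (-K * τ) *
          (Real.exp (-u₂ z τ) - Real.exp (-u₁ z ((1 - κ) * τ))) - ε * ∑ i, z i ^ 2)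
        (Real.exp_pos (K * τ)).le
      have h3 : Real.exp (K * τ) * Real.exp (-K * τ) = 1 := by
        rw [← Real.exp_add]; simp
      have h4 : ∀ a b : ℝ, Real.exp (K * τ) * (Real.exp (-K * τ) * a - ε * b) = a - ε' * b := by
        intro a b
        linear_combination a * h3
      rwa [h4, h4] at h2)
  obtain ⟨hgrad, hhess⟩ := hsp
  set a₁ := Real.exp (-u₁ z ((1 - κ) * τ)) with ha₁
  set a₂ := Real.exp (-u₂ z τ) with ha₂
  have ha₁pos : 0 < a₁ := Real.exp_pos _
  -- As ε|z|² ≤ A, the gradient of the penalty is O(√ε) although z may escape as ε → 0.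
  have hh : ((2 * ε') • fun i => z i) ⬝ᵥ ((2 * ε') • fun i => z i) ≤ (2 * M * √(ε * A)) ^ 2 := by
    have e1 : ((2 * ε') • fun i => z i) ⬝ᵥ ((2 * ε') • fun i => z i)
        = 4 * ε' ^ 2 * ∑ i, z i ^ 2 := by
      rw [sum_sq_eq_dotProduct]
      simp only [smul_dotProduct, dotProduct_smul, smul_eq_mul]
      change _ = 4 * ε' ^ 2 * ((fun i => z i) ⬝ᵥ fun i => z i)
      ring
    rw [e1, mul_pow _ √(ε * A), Real.sq_sqrt (by positivity)]
    calc 4 * ε' ^ 2 * ∑ i, z i ^ 2 ≤ 4 * (ε * M) ^ 2 * ∑ i, z i ^ 2 := by gcongr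
      _ = 4 * M ^ 2 * ε * (ε * ∑ i, z i ^ 2) := by ring
      _ ≤ 4 * M ^ 2 * ε * A := by gcongr
      _ = _ := by ring
  -- This lower bound makes the gradient error small relative to κ a₂.
  have hδa : δ ≤ a₂ := by linarith
  have halg := pairing_graphInv_sub_le (c := c) (κ := κ) (e := 2 * ε')
    (θ := 2 * M * √(ε * A)) ha₁pos (by linarith) hc hκ hκ1 (by positivity) (by positivity) hgrad
    ((mul_le_mul_of_nonneg_left hh zero_le_two).trans (hsmall.trans (by gcongr))) hh hhess
    (hc₂ τ hτ z).le_bform_hess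
  -- time derivative
  have hd₁ : HasDerivWithinAt (fun s => u₁ z ((1 - κ) * s)) _ (Ioc 0 T) τ :=
    (hu₁.hasDerivWithinAt hτ' z).comp τ
      (((hasDerivAt_id τ).const_mul (1 - κ)).hasDerivWithinAt (s := Ioc 0 T))
      fun s hs => mul_mem_Ioc hκ.le hκ1 hs
  have hd₂ := hu₂.hasDerivWithinAt hτ z
  have hdK : HasDerivWithinAt (fun s : ℝ => Real.exp (-K * s)) _ (Ioc 0 T) τ :=
    ((hasDerivAt_id τ).const_mul (-K)).exp.hasDerivWithinAt
  have hdδ : HasDerivWithinAt (fun s : ℝ => δ * (1 + s)) _ (Ioc 0 T) τ :=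
    (((hasDerivAt_id τ).const_add 1).const_mul δ).hasDerivWithinAt
  have hdG := ((hdK.fun_mul (hd₂.fun_neg.exp.fun_sub hd₁.fun_neg.exp)).fun_sub
    (hasDerivWithinAt_const τ (Ioc 0 T) (ε * ∑ i, z i ^ 2))).fun_sub hdδ
  have hfin := deriv_nonneg_of_isMaxOn_Ioc hτ hdG (by
    intro s hs
    have h := hmax' z s ⟨hs.1.le, hs.2⟩
    rw [hGpos z s hs, hGpos z τ hτ] at h
    exact h)
  simp only [id, mul_one, sub_zero, ← ha₁, ← ha₂] at hfin
  set X₁ := pairing (graphInv fun i => pd i (fun y => u₁ y ((1 - κ) * τ)) z)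
    (hess (fun y => u₁ y ((1 - κ) * τ)) z)
  set X₂ := pairing (graphInv fun i => pd i (fun y => u₂ y τ) z) (hess (fun y => u₂ y τ) z)
  have hn : (0 : ℝ) ≤ n := Nat.cast_nonneg n
  have haA : a₂ ≤ A := hA τ hτ z
  have e1 : κ * n * c * a₂ ≤ κ * n * c * A := by gcongr
  have e2 : n * (2 * ε') ≤ n * (2 * (ε * M)) := by gcongr
  -- The flow equations identify the left side with ∂ₜ(a₂ - a₁), so ∂ₜG < 0, against maximality in
  -- time.
  have hlt : (1 - κ) * a₁ * X₁ - a₂ * X₂ < K * (a₂ - a₁) + δ := by linarith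
  have hexpτ := Real.exp_pos (-K * τ)
  have hlt' := mul_lt_mul_of_pos_left hlt hexpτ
  have hle : Real.exp (-K * τ) * δ ≤ δ := mul_le_of_le_one_left hδ.le (hexp1 τ hτ)
  nlinarith

/-- The limit ε → 0 at fixed κ. The choice of δ exceeds the surviving error κncA by exactly κ, yet
still vanishes with κ. -/
lemma exp_sub_exp_le (hu₁ : IsSmoothSolution T u₀ u₁) (hu₂ : IsSmoothSolution T u₀ u₂)
    (h₀ : Continuous u₀) {c A κ : ℝ} (hc : 0 ≤ c)
    (hc₂ : ∀ t ∈ Ioc 0 T, ∀ x, CurvBoundAt c (fun y => u₂ y t) x)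
    (hA : ∀ t ∈ Ioc 0 T, ∀ x, Real.exp (-u₂ x t) ≤ A) (hκ : 0 < κ) (hκ1 : κ < 1) (hT : 0 < T)
    {t : ℝ} (ht : t ∈ Ioc 0 T) (x : E n) :
    Real.exp (-(2 * c + 1) * t) * (Real.exp (-u₂ x t) - Real.exp (-u₁ x ((1 - κ) * t))) ≤
      κ * (n * c * A + 1) * (1 + t) := by
  have hApos : 0 < A := (Real.exp_pos _).trans_le (hA t ht x)
  set δ := κ * (n * c * A + 1) with hδ
  have hδpos : 0 < δ := by positivity
  have l1 : Tendsto (fun ε : ℝ => 2 * (2 * Real.exp ((2 * c + 1) * T) * √(ε * A)) ^ 2)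
      (𝓝[>] 0) (𝓝 (2 * (2 * Real.exp ((2 * c + 1) * T) * √(0 * A)) ^ 2)) :=
    Tendsto.mono_left (Continuous.tendsto (by fun_prop) 0) nhdsWithin_le_nhds
  have l2 : Tendsto (fun ε : ℝ => n * (2 * (ε * Real.exp ((2 * c + 1) * T)))
      + 2 * (1 + c) * (2 * Real.exp ((2 * c + 1) * T) * √(ε * A)) + κ * n * c * A) (𝓝[>] 0)
      (𝓝 (n * (2 * (0 * Real.exp ((2 * c + 1) * T)))
      + 2 * (1 + c) * (2 * Real.exp ((2 * c + 1) * T) * √(0 * A)) + κ * n * c * A)) :=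
    Tendsto.mono_left (Continuous.tendsto (by fun_prop) 0) nhdsWithin_le_nhds
  have l3 : Tendsto (fun ε : ℝ => ε * ∑ i, x i ^ 2 + δ * (1 + t)) (𝓝[>] 0)
      (𝓝 (0 * ∑ i, x i ^ 2 + δ * (1 + t))) :=
    Tendsto.mono_left (Continuous.tendsto (by fun_prop) 0) nhdsWithin_le_nhds
  rw [zero_mul, zero_add] at l3
  refine ge_of_tendsto l3 ?_
  have h1 := l1.eventually_lt_const (u := κ ^ 2 * δ ^ 2) (by
    rw [zero_mul, Real.sqrt_zero, mul_zero, zero_pow two_ne_zero, mul_zero]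
    positivity)
  have h2 := l2.eventually_lt_const (u := δ) (by
    simp only [zero_mul, Real.sqrt_zero, mul_zero, zero_add, hδ]
    linarith)
  filter_upwards [h1, h2, self_mem_nhdsWithin] with ε hε1 hε2 hε
  exact exp_sub_exp_le_penalty hu₁ hu₂ h₀ hc hc₂ hA hκ hκ1 hδpos hε hT hε1.le hε2 ht x

/-- Comparison principle: a solution with initial data bounded below which satisfies the curvature
bound lies above every solution with the same initial data. -/
lemma le_of_curvBound (hT : 0 < T) (hu₁ : IsSmoothSolution T u₀ u₁)
    (hu₂ : IsSmoothSolution T u₀ u₂) (h₀ : Continuous u₀) (hbdd : BddBelow (range u₀))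
    (hc₂ : CurvBound T u₂) {t : ℝ} (ht : t ∈ Ioc 0 T) (x : E n) : u₁ x t ≤ u₂ x t := by
  obtain ⟨c, hc, hcu⟩ := hc₂
  obtain ⟨m, hm⟩ := hbdd
  have hA : ∀ s ∈ Ioc 0 T, ∀ y, Real.exp (-u₂ y s) ≤ Real.exp (-(m - c * n * T)) := by
    intro s hs y
    have h1 := hu₂.initial_sub_le hcu hs y
    have h2 := hm (mem_range_self y)
    have h3 : c * n * s ≤ c * n * T := by
      have := hs.2
      gcongr
    exact Real.exp_le_exp.2 (by linarith)
  -- As κ → 0 the slowed time returns to t from within (0, T], where u₁ is continuous in time.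
  have hlim : Tendsto (fun κ : ℝ => (1 - κ) * t) (𝓝[>] 0) (𝓝[Ioc 0 T] t) := by
    refine tendsto_nhdsWithin_iff.2 ⟨?_, ?_⟩
    · have : Tendsto (fun κ : ℝ => (1 - κ) * t) (𝓝 0) (𝓝 ((1 - 0) * t)) :=
        Continuous.tendsto (by fun_prop) 0
      rw [sub_zero, one_mul] at this
      exact this.mono_left nhdsWithin_le_nhds
    · filter_upwards [Ioo_mem_nhdsGT (zero_lt_one (α := ℝ))] with κ hκ
      exact mul_mem_Ioc hκ.1.le hκ.2 ht
  have hl := ((hu₁.hasDerivWithinAt ht x).continuousWithinAt.tendsto.comp hlim).neg.rexp.const_sub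
    (Real.exp (-u₂ x t)) |>.const_mul (Real.exp (-(2 * c + 1) * t))
  set A := Real.exp (-(m - c * n * T))
  have hr : Tendsto (fun κ : ℝ => κ * (n * c * A + 1) * (1 + t)) (𝓝[>] 0)
      (𝓝 (0 * (n * c * A + 1) * (1 + t))) :=
    Tendsto.mono_left (Continuous.tendsto (by fun_prop) 0) nhdsWithin_le_nhds
  have h := le_of_tendsto_of_tendsto hl hr (by
    filter_upwards [Ioo_mem_nhdsGT (zero_lt_one (α := ℝ))] with κ hκ
    exact exp_sub_exp_le hu₁ hu₂ h₀ hc.le hcu hA hκ.1 hκ.2 hT ht x)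
  rw [zero_mul, zero_mul] at h
  have h' := nonpos_of_mul_nonpos_right h (Real.exp_pos _)
  have := Real.exp_le_exp.1 (sub_nonpos.1 h')
  linarith

end Comparison

end

end GraphMCF

theorem theorem4p6 (n : ℕ) (T : ℝ) (hT : 0 < T)
    (u₀ : GraphMCF.E n → ℝ) (hLip : LocallyLipschitz u₀)
    (hbdd : BddBelow (Set.range u₀)) (hgrad : GraphMCF.GradBddOnSublevels u₀)
    (u₁ u₂ : GraphMCF.E n → ℝ → ℝ)
    (hu₁ : GraphMCF.IsSmoothSolution T u₀ u₁) (hu₂ : GraphMCF.IsSmoothSolution T u₀ u₂)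
    (hc₁ : GraphMCF.CurvBound T u₁) (hc₂ : GraphMCF.CurvBound T u₂) :
    (∀ t ∈ Set.Ioc 0 T, ∀ x, u₁ x t = u₂ x t) ∧
      ∀ t ∈ Set.Ioc 0 T,
        GraphMCF.entireGraph (fun x => u₁ x t) = GraphMCF.entireGraph (fun x => u₂ x t) := by
  have h : ∀ t ∈ Set.Ioc 0 T, ∀ x, u₁ x t = u₂ x t := fun t ht x =>
    le_antisymm (GraphMCF.le_of_curvBound hT hu₁ hu₂ hLip.continuous hbdd hc₂ ht x)
      (GraphMCF.le_of_curvBound hT hu₂ hu₁ hLip.continuous hbdd hc₁ ht x)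
  exact ⟨h, fun t ht => by simp only [h t ht]⟩
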